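/- Let $B=(B(t))_{t\ge 0}$ be a Brownian motion on a probability space $(\Omega,\mathcal F,\mathrm P)$, let $H\in(0,1)$ and $T>0$, and let $\{q(i,\cdot)\}_{i=0}^\infty$ be any orthonormal basis of $L_2([0,T])$. For $0<\tau<t$ put $$k_H(t,\tau)=\frac{a_H}{\Gamma(H+\frac12)}\,(t-\tau)^{H-1/2}\,{}_2F_1\Bigl(\tfrac12-H,\;H-\tfrac12;\;H+\tfrac12;\;1-\tfrac t\tau\Bigr),\qquad a_H=\sqrt{\frac{2H\,\Gamma(H+\frac12)\,\Gamma(\frac32-H)}{\Gamma(2-2H)}},$$ and $k_H(t,\tau)=0$ for $t\le\tau$, where ${}_2F_1$ is the (analytically continued) Gauss hypergeometric function. Let $B_H(t)=\int_0^t k_H(t,\tau)\,dB(\tau)$, $t\in[0,T]$, be the fractional Brownian motion with Hurst index $H$ (in a jointly measurable version), the integral being the Wiener integral; these integrals exist. Then $k_H\in L_2([0,T]^2)$, almost every path of $B_H$ lies in $L_2([0,T])$, and one can define, for $i,j=0,1,2,\dots$, $$\mathcal B^H_i=\int_0^T q(i,t)\,B_H(t)\,dt,\qquad K^H_{ij}=\int_0^T\!\!\int_0^T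 q(i,t)\,q(j,\tau)\,k_H(t,\tau)\,d\tau\,dt,\qquad \mathcal V_i=\int_0^T q(i,t)\,dB(t).$$ The matrix $K^H$ is also the matrix of the integral operator $(\mathcal K_H\varphi)(t)=\int_0^t k_H(t,\tau)\varphi(\tau)\,d\tau$, that is, $K^H_{ij}=\int_0^T q(i,t)\,(\mathcal K_H q(j,\cdot))(t)\,dt$. The random variables $\mathcal V_0,\mathcal V_1,\dots$ are independent and standard normal, and $$\mathcal B^H=K^H\mathcal V,\qquad\text{i.e.}\qquad \mathcal B^H_i=\sum_{j=0}^\infty K^H_{ij}\,\mathcal V_j,\quad i=0,1,2,\dots,$$ where each series converges almost surely (in the order $j=0,1,2,\dots$) and unconditionally in mean square. -/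

import Mathlib

open MeasureTheory ProbabilityTheory Filter Set
open scoped Topology ENNReal NNReal

noncomputable section

namespace SpectralFBM

/-! ### The kernel of the fractional Brownian motion -/

/-- The Gauss hypergeometric function `₂F₁(a, b; c; z)` for real `z < 1`: the power series for
`|z| < 1`, and its analytic continuation to `z ≤ -1`, given by
`₂F₁(a, b; c; z) = (1 - z) ^ (-a) ₂F₁(a, c - b; c; z / (z - 1))`, where `1/2 ≤ z / (z - 1) < 1`
(Mathlib's `₂F₁` is the sum of the series and takes junk values where the series diverges). -/
def hyp2F1 (a b c z : ℝ) : ℝ :=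
  if |z| < 1 then ₂F₁ a b c z else (1 - z) ^ (-a) * ₂F₁ a (c - b) c (z / (z - 1))

/-- The constant `a_H`. -/
def aConst (H : ℝ) : ℝ :=
  √(2 * H * Real.Gamma (H + 1 / 2) * Real.Gamma (3 / 2 - H) / Real.Gamma (2 - 2 * H))

/-- The kernel `k_H(t, τ)`, which vanishes for `t ≤ τ`. With the factor `1 / Γ(H + 1/2)` it is the
kernel that satisfies
`∫ θ in 0..min t τ, k_H t θ * k_H τ θ = (t ^ (2 * H) + τ ^ (2 * H) - |t - τ| ^ (2 * H)) / 2`. -/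
def kernel (H t τ : ℝ) : ℝ :=
  if τ < t then
    aConst H / Real.Gamma (H + 1 / 2) * (t - τ) ^ (H - 1 / 2) *
      hyp2F1 (1 / 2 - H) (H - 1 / 2) (H + 1 / 2) (1 - t / τ)
  else 0

/-- The linear integral operator `φ ↦ ∫_0^t k(t, τ) φ(τ) dτ` with kernel `k`. -/
def kernelOperator (k : ℝ → ℝ → ℝ) (φ : ℝ → ℝ) (t : ℝ) : ℝ :=
  ∫ τ in (0 : ℝ)..t, k t τ * φ τ

/-! ### The Wiener integral -/

section Wiener

variable {Ω : Type*} [MeasurableSpace Ω]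

/-- The step function `∑ a · 1_{(u, v]}`, given by its finitely many intervals `(u, v]` and their
coefficients `a`. -/
def stepFun (c : (ℝ≥0 × ℝ≥0) →₀ ℝ) (t : ℝ) : ℝ :=
  c.sum fun p a => a * (Ioc (p.1 : ℝ) (p.2 : ℝ)).indicator (fun _ => 1) t

/-- The stochastic integral `∑ a · (B(v) - B(u))` of the step function `∑ a · 1_{(u, v]}`. -/
def stepIntegral (B : ℝ≥0 → Ω → ℝ) (c : (ℝ≥0 × ℝ≥0) →₀ ℝ) (ω : Ω) : ℝ :=
  c.sum fun p a => a * (B p.2 ω - B p.1 ω)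

/-- `X` is (a version of) the Wiener integral `∫_0^S f(t) dB(t)` of `f ∈ L²([0, S])`: it is the
limit in `L²(P)` of the stochastic integrals of step functions on `[0, S]` that converge to `f`
in `L²([0, S])`. -/
def IsWienerIntegral (B : ℝ≥0 → Ω → ℝ) (P : Measure Ω) (S : ℝ) (f : ℝ → ℝ) (X : Ω → ℝ) : Prop :=
  MemLp f 2 (volume.restrict (Icc 0 S)) ∧ MemLp X 2 P ∧
    ∃ c : ℕ → (ℝ≥0 × ℝ≥0) →₀ ℝ,
      (∀ n, ∀ p ∈ (c n).support, p.1 ≤ p.2 ∧ (p.2 : ℝ) ≤ S) ∧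
      Tendsto (fun n => eLpNorm (fun t => stepFun (c n) t - f t) 2 (volume.restrict (Icc 0 S)))
        atTop (𝓝 0) ∧
      Tendsto (fun n => eLpNorm (fun ω => stepIntegral B (c n) ω - X ω) 2 P) atTop (𝓝 0)

open Classical in
/-- The Wiener integral `∫_0^S f(t) dB(t)` (determined up to almost sure equality). -/
def wienerIntegral (B : ℝ≥0 → Ω → ℝ) (P : Measure Ω) (S : ℝ) (f : ℝ → ℝ) : Ω → ℝ :=
  if h : ∃ X, IsWienerIntegral B P S f X then h.choose else 0

end Wiener

/-! ### Spectral characteristics -/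

/-- The Lebesgue measure on `[0, T]`. -/
abbrev vol (T : ℝ) : Measure ℝ := volume.restrict (Icc 0 T)

section Spectral

variable {T : ℝ} (q : HilbertBasis ℕ ℝ (Lp ℝ 2 (vol T)))

/-- The spectral characteristic of a function `φ ∈ L²([0, T])`. -/
def specFun (φ : ℝ → ℝ) (i : ℕ) : ℝ :=
  ∫ t, q i t * φ t ∂(vol T)

/-- The two-dimensional spectral characteristic of a function `k ∈ L²([0, T]²)`. -/
def specKernel (k : ℝ → ℝ → ℝ) (i j : ℕ) : ℝ :=
  ∫ p, (q i p.1 * q j p.2) * k p.1 p.2 ∂((vol T).prod (vol T))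

/-- The spectral characteristic of a linear operator on (functions representing elements of)
`L²([0, T])`. -/
def specOperator (A : (ℝ → ℝ) → ℝ → ℝ) (i j : ℕ) : ℝ :=
  ∫ t, q i t * A (q j) t ∂(vol T)

/-- The spectral characteristic of the Gaussian white noise associated with `B`. -/
def specWhiteNoise {Ω : Type*} [MeasurableSpace Ω] (B : ℝ≥0 → Ω → ℝ) (P : Measure Ω) (i : ℕ) :
    Ω → ℝ :=
  wienerIntegral B P T (q i)

end Spectral

end SpectralFBM

end

namespace SpectralFBM

/-! ### Bounds on the hypergeometric kernel -/

/-! The Wiener integral is an isometry `W : L²([0, T]) → L²(P)` with Gaussian values, and `B_H(t) =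
W(k_t)` with `k_t = k_H(t, ·)`. The coefficient `X_i = ∫ q_i(t) B_H(t) dt` is a path-by-path
integral, but it is determined in `L²(P)` by the pairings `⟨X_i, Y⟩ = ∫ q_i(t) ⟨W k_t, Y⟩ dt`, which
need only ordinary Fubini. These pairings show `W W* X_i = X_i`, so `X_i` lies in the range of `W`
and no stochastic Fubini theorem is needed. Expanding `W* X_i` in the basis `q` and applying `W`
gives `X_i = ∑ ⟨W q_j, X_i⟩ W q_j`, and the pairing formula with `Y = W q_j` identifies the
coefficient as `K_ij` (`hasSum_specKernel`). This is unconditional convergence in mean square. The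
variables `W q_j` are independent standard normal, so the partial sums form an `L²`-bounded
martingale, whose almost sure limit must be the same `X_i` (`ae_tendsto_sum_of_hasSum`).

The analytic input is `k_H ∈ L²`. With `α = H - 1/2`, the hypergeometric factor is at most `C
(t/τ)^γ` for some `γ < 1/2` (`exists_abs_hyp2F1_le`). Hence `∫ k_H(t, τ)² dτ` is dominated by a
convergent Beta integral, uniformly in `t ∈ [0, T]` (`exists_lintegral_kernel_sq_le`). -/

lemma ascPochhammer_eval_mul_add (x : ℝ) (n : ℕ) :
    (ascPochhammer ℝ n).eval x * (x + n) = x * (ascPochhammer ℝ n).eval (1 + x) := by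
  induction n with
  | zero => simp
  | succ n ih =>
    rw [ascPochhammer_succ_eval, ascPochhammer_succ_eval, ih]
    push_cast
    ring

lemma abs_ascPochhammer_eval_le {x : ℝ} (hx : |x| ≤ 1 / 2) (n : ℕ) :
    |(ascPochhammer ℝ n).eval x| ≤ (ascPochhammer ℝ n).eval (1 / 2) := by
  induction n with
  | zero => simp
  | succ n ih =>
    rw [ascPochhammer_succ_eval, ascPochhammer_succ_eval, abs_mul]
    refine mul_le_mul ih ?_ (abs_nonneg _) ((abs_nonneg _).trans ih)
    calc |x + n| ≤ |x| + |(n : ℝ)| := abs_add_le _ _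
      _ ≤ 1 / 2 + n := by rw [Nat.abs_cast]; gcongr

/-- A Wallis-type bound: passing from `n` to `n + 1` multiplies the left side by `(2n+1)(2n+3) /
(2n+2)² < 1`. -/
lemma ascPochhammer_half_div_factorial_sq_le (n : ℕ) :
    (((n.factorial : ℝ)⁻¹ * (ascPochhammer ℝ n).eval (1 / 2)) ^ 2) * (2 * n + 1) ≤ 1 := by
  induction n with
  | zero => simp
  | succ n ih =>
    rw [ascPochhammer_succ_eval, Nat.factorial_succ]
    set p := (ascPochhammer ℝ n).eval (1 / 2)
    have h : ((((n + 1) * n.factorial : ℕ) : ℝ)⁻¹ * (p * (1 / 2 + n))) ^ 2 *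
        (2 * ((n + 1 : ℕ) : ℝ) + 1) =
        (((n.factorial : ℝ)⁻¹ * p) ^ 2 * (2 * n + 1)) *
          ((2 * n + 1) * (2 * n + 3) / (4 * (n + 1) ^ 2)) := by
      push_cast
      have := n.factorial_pos
      field_simp
      ring
    rw [h]
    refine mul_le_one₀ ih (by positivity) ?_
    rw [div_le_one (by positivity)]
    nlinarith

lemma ascPochhammer_half_div_factorial_le {n : ℕ} (hn : n ≠ 0) :
    (n.factorial : ℝ)⁻¹ * (ascPochhammer ℝ n).eval (1 / 2) ≤ (n : ℝ) ^ (-(1 / 2) : ℝ) := by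
  have hn' : (0 : ℝ) < n := by positivity
  refine le_of_sq_le_sq ?_ (by positivity)
  have h2 : ((n : ℝ) ^ (-(1 / 2) : ℝ)) ^ 2 = (n : ℝ)⁻¹ := by
    rw [← Real.rpow_natCast ((n : ℝ) ^ (-(1 / 2) : ℝ)), ← Real.rpow_mul hn'.le]
    norm_num
    exact Real.rpow_neg_one _
  rw [h2, ← one_div (n : ℝ), le_div_iff₀ hn']
  refine le_trans ?_ (ascPochhammer_half_div_factorial_sq_le n)
  gcongr
  linarith

section Coefficients

variable {α : ℝ} (hα : |α| < 1 / 2)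

include hα

/-- The quotient `(α)_n / (α+1)_n` telescopes to `α / (α + n)`, of order `1/n`, and `(-α)_n / n!` is
at most `n^(-1/2)`. The series therefore converges absolutely up to `|z| = 1`, with a bound uniform
in `z`. -/
lemma abs_coeff_near_le {n : ℕ} (hn : n ≠ 0) :
    |ordinaryHypergeometricCoefficient (-α) α (α + 1) n| ≤ (n : ℝ) ^ (-(3 / 2) : ℝ) := by
  obtain ⟨h1, h2⟩ := abs_lt.1 hα
  have hn' : (1 : ℝ) ≤ n := by exact_mod_cast Nat.one_le_iff_ne_zero.2 hn
  have hpos : 0 < (ascPochhammer ℝ n).eval (α + 1) := ascPochhammer_pos n _ (by linarith)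
  have hq : (ascPochhammer ℝ n).eval α * ((ascPochhammer ℝ n).eval (α + 1))⁻¹ = α / (α + n) := by
    have := ascPochhammer_eval_mul_add α n
    rw [add_comm 1 α] at this
    have h : α + n ≠ 0 := by linarith
    rw [← div_eq_mul_inv, div_eq_div_iff hpos.ne' h, this]
  have hq' : |α / (α + n)| ≤ (n : ℝ)⁻¹ := by
    have h0 : 0 < α + n := by linarith
    rw [abs_div, abs_of_pos h0, div_le_iff₀ h0, ← div_eq_inv_mul, le_div_iff₀ (by linarith)]
    nlinarith
  have hp : |(n.factorial : ℝ)⁻¹ * (ascPochhammer ℝ n).eval (-α)| ≤ (n : ℝ) ^ (-(1 / 2) : ℝ) := by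
    refine le_trans ?_ (ascPochhammer_half_div_factorial_le hn)
    rw [abs_mul, abs_of_pos (by positivity)]
    gcongr
    exact abs_ascPochhammer_eval_le (by rw [abs_neg]; exact hα.le) n
  calc |ordinaryHypergeometricCoefficient (-α) α (α + 1) n|
      = |(n.factorial : ℝ)⁻¹ * (ascPochhammer ℝ n).eval (-α)| * |α / (α + n)| := by
        rw [← hq, ← abs_mul]
        ring_nf
    _ ≤ (n : ℝ) ^ (-(1 / 2) : ℝ) * (n : ℝ)⁻¹ := by gcongr
    _ = (n : ℝ) ^ (-(3 / 2) : ℝ) := by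
        rw [← Real.rpow_neg_one, ← Real.rpow_add (by linarith)]
        norm_num

lemma summable_abs_coeff_near :
    Summable fun n => |ordinaryHypergeometricCoefficient (-α) α (α + 1) n| := by
  rw [← summable_nat_add_iff 1]
  refine Summable.of_nonneg_of_le (fun _ => abs_nonneg _)
    (fun n => abs_coeff_near_le hα n.succ_ne_zero) ?_
  exact (summable_nat_add_iff 1).2 (Real.summable_nat_rpow.2 (by norm_num))

/-- Comparison with the binomial series by ratios of consecutive coefficients: for `n ≥ 1`, `(n -
α)/(n + α + 1) ≤ (n + δ)/(n + 1)`, which is where `-2α ≤ δ` enters. -/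
lemma abs_coeff_far_le {δ : ℝ} (hδ : 0 < δ) (hδα : -2 * α ≤ δ) (n : ℕ) :
    |ordinaryHypergeometricCoefficient (-α) 1 (α + 1) n| ≤
      (1 + δ⁻¹) * ordinaryHypergeometricCoefficient δ 1 1 n := by
  obtain ⟨h1, h2⟩ := abs_lt.1 hα
  have hα1 : 0 < α + 1 := by linarith
  have key (m : ℕ) (x c : ℝ) (hc : 0 < c) :
      ordinaryHypergeometricCoefficient x 1 c (m + 1) =
        ordinaryHypergeometricCoefficient x 1 c m * ((x + m) / (c + m)) := by
    have := (ascPochhammer_pos m c hc).ne'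
    have hm : c + m ≠ 0 := ne_of_gt (by positivity)
    simp only [ordinaryHypergeometricCoefficient, ascPochhammer_succ_eval, Nat.factorial_succ]
    push_cast
    field_simp
    ring
  induction n with
  | zero =>
    simp [ordinaryHypergeometricCoefficient]
    positivity
  | succ n ih =>
    rw [key n _ _ (by linarith), key n _ _ one_pos, abs_mul, abs_div,
      abs_of_pos (show 0 < α + 1 + n by positivity)]
    rcases Nat.eq_zero_or_pos n with rfl | hn
    -- The ratio comparison can fail from `n = 0` to `n = 1`; the factor `1 + δ⁻¹` absorbs it, since
    -- `|α|/(α+1) < 1 ≤ (1 + δ⁻¹) δ`.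
    · simp [ordinaryHypergeometricCoefficient]
      rw [div_le_iff₀ (by linarith)]
      have : (1 + δ⁻¹) * δ = δ + 1 := by field_simp
      rw [this]
      nlinarith
    · have hn' : (1 : ℝ) ≤ n := by exact_mod_cast hn
      rw [← mul_assoc]
      refine mul_le_mul ih ?_ (by positivity) ((abs_nonneg _).trans ih)
      rw [abs_of_nonneg (by linarith), div_le_div_iff₀ (by positivity) (by positivity)]
      nlinarith [mul_nonneg (sub_nonneg.2 hδα) (sub_nonneg.2 hn')]

end Coefficients

lemma hasSum_binomial (δ : ℝ) {w : ℝ} (hw0 : 0 ≤ w) (hw1 : w < 1) :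
    HasSum (fun n => ordinaryHypergeometricCoefficient δ 1 1 n * w ^ n) ((1 - w) ^ (-δ)) := by
  -- The binomial series of `(1 + x)^(-δ)` at `x = -w`; the equal parameters `b = c = 1` cancel and
  -- leave `(δ)_n / n!`.
  have h := (Real.one_add_rpow_hasFPowerSeriesOnBall_zero (a := -δ)).hasSum (y := -w)
    (by simp [enorm_eq_nnnorm, ← NNReal.coe_lt_coe, abs_of_nonneg hw0, hw1])
  rw [binomialSeries_eq_ordinaryHypergeometricSeries (b := (1 : ℝ))
    (fun k => (neg_one_lt_zero.trans_le k.cast_nonneg).ne')] at h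
  have e (n : ℕ) : ((ordinaryHypergeometricSeries ℝ (- -δ) 1 1).compContinuousLinearMap
      (-ContinuousLinearMap.id ℝ ℝ) n fun _ => -w) =
      ordinaryHypergeometricCoefficient δ 1 1 n * w ^ n := by
    rw [FormalMultilinearSeries.compContinuousLinearMap_apply]
    rw [neg_neg]
    exact (congrArg _ (by ext; simp)).trans (ordinaryHypergeometricSeries_apply_eq δ 1 1 w n)
  simp only [e, zero_add] at h
  rwa [← sub_eq_add_neg] at h

lemma abs_le_of_hasSum {f g : ℕ → ℝ} {a b : ℝ} (hf : HasSum f a) (hg : HasSum g b)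
    (h : ∀ n, |f n| ≤ g n) : |a| ≤ b := by
  rw [← hf.tsum_eq, ← Real.norm_eq_abs]
  exact tsum_of_norm_bounded hg h

section Hypergeometric

variable {α : ℝ} (hα : |α| < 1 / 2)

include hα

lemma summable_abs_near {z : ℝ} (hz : |z| < 1) :
    Summable fun n => |ordinaryHypergeometricCoefficient (-α) α (α + 1) n * z ^ n| := by
  refine (summable_abs_coeff_near hα).of_nonneg_of_le (fun _ => abs_nonneg _) fun n => ?_
  rw [abs_mul, abs_pow]
  exact mul_le_of_le_one_right (abs_nonneg _) (pow_le_one₀ (abs_nonneg _) hz.le)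

lemma hasSum_near {z : ℝ} (hz : |z| < 1) :
    HasSum (fun n => ordinaryHypergeometricCoefficient (-α) α (α + 1) n * z ^ n)
      (₂F₁ (-α) α (α + 1) z) := by
  simpa only [ordinaryHypergeometric_eq_tsum, smul_eq_mul] using
    (summable_abs_near hα hz).of_abs.hasSum

lemma abs_near_le {z : ℝ} (hz : |z| < 1) :
    |₂F₁ (-α) α (α + 1) z| ≤ ∑' n, |ordinaryHypergeometricCoefficient (-α) α (α + 1) n| := by
  refine abs_le_of_hasSum (hasSum_near hα hz) (summable_abs_coeff_near hα).hasSum fun n => ?_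
  rw [abs_mul, abs_pow]
  exact mul_le_of_le_one_right (abs_nonneg _) (pow_le_one₀ (abs_nonneg _) hz.le)

lemma abs_far_term_le {δ : ℝ} (hδ : 0 < δ) (hδα : -2 * α ≤ δ) {w : ℝ} (hw0 : 0 ≤ w) (n : ℕ) :
    |ordinaryHypergeometricCoefficient (-α) 1 (α + 1) n * w ^ n| ≤
      (1 + δ⁻¹) * (ordinaryHypergeometricCoefficient δ 1 1 n * w ^ n) := by
  rw [abs_mul, abs_of_nonneg (pow_nonneg hw0 n), ← mul_assoc]
  gcongr
  exact abs_coeff_far_le hα hδ hδα n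

lemma summable_abs_far {w : ℝ} (hw0 : 0 ≤ w) (hw1 : w < 1) :
    Summable fun n => |ordinaryHypergeometricCoefficient (-α) 1 (α + 1) n * w ^ n| := by
  obtain ⟨h1, h2⟩ := abs_lt.1 hα
  exact ((hasSum_binomial 1 hw0 hw1).summable.mul_left _).of_nonneg_of_le (fun _ => abs_nonneg _)
    (abs_far_term_le hα one_pos (by linarith) hw0)

lemma hasSum_far {w : ℝ} (hw0 : 0 ≤ w) (hw1 : w < 1) :
    HasSum (fun n => ordinaryHypergeometricCoefficient (-α) 1 (α + 1) n * w ^ n)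
      (₂F₁ (-α) 1 (α + 1) w) := by
  simpa only [ordinaryHypergeometric_eq_tsum, smul_eq_mul] using
    (summable_abs_far hα hw0 hw1).of_abs.hasSum

lemma abs_far_le {δ : ℝ} (hδ : 0 < δ) (hδα : -2 * α ≤ δ) {w : ℝ} (hw0 : 0 ≤ w) (hw1 : w < 1) :
    |₂F₁ (-α) 1 (α + 1) w| ≤ (1 + δ⁻¹) * (1 - w) ^ (-δ) := by
  exact abs_le_of_hasSum (hasSum_far hα hw0 hw1) ((hasSum_binomial δ hw0 hw1).mul_left (1 + δ⁻¹))
    (abs_far_term_le hα hδ hδα hw0)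

/-- For `z ≤ -1`, put `w = z/(z-1)`, so that `1 - w = (1 - z)⁻¹`. The binomial comparison bounds the
transformed series by a multiple of `(1 - z)^δ`, and the prefactor `(1 - z)^α` turns the exponent
into `α + δ`. -/
lemma exists_abs_hyp2F1_le :
    ∃ C γ : ℝ, 0 ≤ C ∧ 0 ≤ γ ∧ γ < 1 / 2 ∧
      ∀ z < 0, |hyp2F1 (-α) α (α + 1) z| ≤ C * (1 - z) ^ γ := by
  obtain ⟨h1, h2⟩ := abs_lt.1 hα
  have hγ0 : 0 ≤ 1 / 4 + |α| / 2 := by positivity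
  -- Chosen so that `α + δ` is the midpoint of `|α|` and `1/2`: above `|α|` for `δ > 0` and `-2α ≤
  -- δ`, below `1/2` for square integrability.
  set δ : ℝ := 1 / 4 + |α| / 2 - α with hδ_def
  have hδ : 0 < δ ∧ -2 * α ≤ δ := by
    constructor <;> cases abs_cases α <;> linarith
  set C₁ := ∑' n, |ordinaryHypergeometricCoefficient (-α) α (α + 1) n|
  have hC₁ : 0 ≤ C₁ := tsum_nonneg fun _ => abs_nonneg _
  have hC₂ : 0 ≤ 1 + δ⁻¹ := by have := hδ.1; positivity
  refine ⟨max C₁ (1 + δ⁻¹), 1 / 4 + |α| / 2, le_max_of_le_left hC₁, hγ0, by linarith,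
    fun z hz => ?_⟩
  have hz1 : 0 < 1 - z := by linarith
  unfold hyp2F1
  split_ifs with h
  · calc |₂F₁ (-α) α (α + 1) z| ≤ C₁ * 1 := by rw [mul_one]; exact abs_near_le hα h
      _ ≤ _ := by
        gcongr
        · exact le_max_left _ _
        · exact Real.one_le_rpow (by linarith) hγ0
  · have hw : 1 - z / (z - 1) = (1 - z)⁻¹ := by
      have : z - 1 ≠ 0 := by linarith
      have : 1 - z ≠ 0 := by linarith
      field_simp
      ring
    have hw1 : z / (z - 1) < 1 := by
      have : 0 < (1 - z)⁻¹ := by positivity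
      linarith
    have hw0 : 0 ≤ z / (z - 1) := div_nonneg_of_nonpos hz.le (by linarith)
    have hb := abs_far_le hα hδ.1 hδ.2 hw0 hw1
    rw [hw, Real.inv_rpow hz1.le, ← Real.rpow_neg hz1.le, neg_neg] at hb
    rw [neg_neg, add_sub_cancel_left, abs_mul, abs_of_pos (Real.rpow_pos_of_pos hz1 _)]
    calc (1 - z) ^ α * |₂F₁ (-α) 1 (α + 1) (z / (z - 1))|
        ≤ (1 - z) ^ α * ((1 + δ⁻¹) * (1 - z) ^ δ) := by gcongr
      _ = (1 + δ⁻¹) * (1 - z) ^ (1 / 4 + |α| / 2) := by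
        rw [mul_left_comm, ← Real.rpow_add hz1, hδ_def, add_sub_cancel]
      _ ≤ _ := by gcongr; exact le_max_right _ _

/-- A pointwise limit of partial sums. The restriction to `z < 0` keeps the argument `z/(z-1)` of
the second branch in `[0, 1)`, where its series converges. -/
lemma measurable_indicator_hyp2F1 : Measurable ((Iio 0).indicator (hyp2F1 (-α) α (α + 1))) := by
  have hm (f g : ℝ → ℝ) (hf : Measurable f) (hg : Measurable g) :
      Measurable fun z => if |z| < 1 then f z else g z :=
    Measurable.ite (measurableSet_lt (by fun_prop) (by fun_prop)) hf hg
  refine measurable_of_tendsto_metrizable (f := fun N => (Iio 0).indicator fun z =>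
    if |z| < 1 then ∑ n ∈ Finset.range N, ordinaryHypergeometricCoefficient (-α) α (α + 1) n * z ^ n
    else (1 - z) ^ α * ∑ n ∈ Finset.range N,
      ordinaryHypergeometricCoefficient (-α) 1 (α + 1) n * (z / (z - 1)) ^ n)
    (fun N => (hm _ _ (by fun_prop) (by fun_prop)).indicator measurableSet_Iio) ?_
  rw [tendsto_pi_nhds]
  intro z
  by_cases hz : z < 0
  · simp only [indicator_of_mem (mem_Iio.2 hz), hyp2F1]
    split_ifs with h
    · exact (hasSum_near hα h).tendsto_sum_nat
    · rw [neg_neg, add_sub_cancel_left]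
      refine (hasSum_far hα (div_nonneg_of_nonpos hz.le (by linarith)) ?_).tendsto_sum_nat.const_mul _
      rw [div_lt_one_of_neg (by linarith)]
      linarith
  · simp [indicator_of_notMem (show z ∉ Iio 0 from hz)]

end Hypergeometric

lemma exists_abs_kernel_le {H : ℝ} (hH0 : 0 < H) (hH1 : H < 1) :
    ∃ C γ : ℝ, 0 ≤ C ∧ 0 ≤ γ ∧ γ < 1 / 2 ∧ ∀ t τ, 0 < τ → τ < t →
      |kernel H t τ| ≤ C * (t - τ) ^ (H - 1 / 2) * (t / τ) ^ γ := by
  obtain ⟨C, γ, hC, hγ0, hγ, h⟩ := exists_abs_hyp2F1_le (α := H - 1 / 2)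
    (abs_lt.2 ⟨by linarith, by linarith⟩)
  refine ⟨|aConst H / Real.Gamma (H + 1 / 2)| * C, γ, by positivity, hγ0, hγ, fun t τ hτ ht => ?_⟩
  have hz := h (1 - t / τ) (by rw [sub_neg, lt_div_iff₀ hτ]; linarith)
  rw [sub_sub_cancel] at hz
  rw [kernel, if_pos ht, abs_mul, abs_mul, abs_of_pos (Real.rpow_pos_of_pos (sub_pos.2 ht) _),
    show 1 / 2 - H = -(H - 1 / 2) by ring, show H + 1 / 2 = H - 1 / 2 + 1 by ring]
  have := (sub_pos.2 ht).le
  calc _ ≤ |aConst H / Real.Gamma (H - 1 / 2 + 1)| * (t - τ) ^ (H - 1 / 2) *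
        (C * (t / τ) ^ γ) := by gcongr
    _ = _ := by ring

lemma measurable_indicator_kernel {H : ℝ} (hH0 : 0 < H) (hH1 : H < 1) :
    Measurable ({p : ℝ × ℝ | 0 < p.2}.indicator fun p => kernel H p.1 p.2) := by
  have hα : |H - 1 / 2| < 1 / 2 := abs_lt.2 ⟨by linarith, by linarith⟩
  have hs : MeasurableSet {p : ℝ × ℝ | 0 < p.2 ∧ p.2 < p.1} :=
    (measurableSet_lt measurable_const measurable_snd).inter
      (measurableSet_lt measurable_snd measurable_fst)
  have he : ({p : ℝ × ℝ | 0 < p.2}.indicator fun p => kernel H p.1 p.2) =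
      {p : ℝ × ℝ | 0 < p.2 ∧ p.2 < p.1}.indicator fun p =>
        aConst H / Real.Gamma (H + 1 / 2) * (p.1 - p.2) ^ (H - 1 / 2) *
          (Iio 0).indicator (hyp2F1 (-(H - 1 / 2)) (H - 1 / 2) (H - 1 / 2 + 1))
            (1 - p.1 / p.2) := by
    ext ⟨t, τ⟩
    by_cases hτ : 0 < τ
    · by_cases ht : τ < t
      · have hz : 1 - t / τ < 0 := by rw [sub_neg, lt_div_iff₀ hτ]; linarith
        simp only [indicator, mem_ofPred_eq, hτ, ht, and_self, if_true, mem_Iio, hz, kernel]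
        ring_nf
      · simp [indicator, hτ, ht, kernel]
    · simp [indicator, hτ]
  rw [he]
  exact ((by fun_prop : Measurable fun p : ℝ × ℝ =>
    aConst H / Real.Gamma (H + 1 / 2) * (p.1 - p.2) ^ (H - 1 / 2)).mul
    ((measurable_indicator_hyp2F1 hα).comp (by fun_prop))).indicator hs

end SpectralFBM

namespace SpectralFBM

/-! ### Square integrability of the kernel -/

lemma integrableOn_beta {u v : ℝ} (hu : 0 < u) (hv : 0 < v) :
    IntegrableOn (fun x : ℝ => x ^ (u - 1) * (1 - x) ^ (v - 1)) (Ioo 0 1) := by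
  have h := (Complex.betaIntegral_convergent (u := u) (v := v) (by simpa) (by simpa)).norm
  rw [intervalIntegrable_iff_integrableOn_Ioo_of_le zero_le_one] at h
  refine h.congr_fun (fun x hx => ?_) measurableSet_Ioo
  have h1 : (1 : ℂ) - x = ((1 - x : ℝ) : ℂ) := by push_cast; rfl
  dsimp only
  rw [norm_mul, Complex.norm_cpow_eq_rpow_re_of_pos hx.1, h1,
    Complex.norm_cpow_eq_rpow_re_of_pos (sub_pos.2 hx.2)]
  simp

lemma integrableOn_scaled_beta {u v t : ℝ} (hu : 0 < u) (hv : 0 < v) (ht : 0 < t) :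
    IntegrableOn (fun x : ℝ => (x / t) ^ (u - 1) * (1 - x / t) ^ (v - 1)) (Ioo 0 t) ∧
    ∫ x in Ioo 0 t, (x / t) ^ (u - 1) * (1 - x / t) ^ (v - 1) =
      t * ∫ x in Ioo (0 : ℝ) 1, x ^ (u - 1) * (1 - x) ^ (v - 1) := by
  have h := integrableOn_beta hu hv
  rw [← intervalIntegrable_iff_integrableOn_Ioo_of_le zero_le_one] at h
  constructor
  · rw [← intervalIntegrable_iff_integrableOn_Ioo_of_le ht.le]
    have := h.comp_mul_right (c := t⁻¹)
    simpa [div_eq_mul_inv] using this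
  · rw [← integral_Ioc_eq_integral_Ioo, ← integral_Ioc_eq_integral_Ioo,
      ← intervalIntegral.integral_of_le ht.le, ← intervalIntegral.integral_of_le zero_le_one]
    have := intervalIntegral.integral_comp_div (a := 0) (b := t)
      (fun x : ℝ => x ^ (u - 1) * (1 - x) ^ (v - 1)) ht.ne'
    simpa [ht.ne'] using this

lemma ae_vol_pos (T : ℝ) : ∀ᵐ τ ∂(vol T), 0 < τ := by
  have h : ∀ᵐ τ : ℝ ∂volume, τ ≠ 0 := by simp [ae_iff]
  filter_upwards [ae_restrict_of_ae h, ae_restrict_mem measurableSet_Icc] with τ h1 h2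
  exact lt_of_le_of_ne h2.1 (Ne.symm h1)

section

variable {H : ℝ} (hH0 : 0 < H) (hH1 : H < 1)

include hH0 hH1

/-- After the substitution `τ = t x`, the squared kernel bound integrates to `C² t^(2H)` times the
Beta integral with parameters `1 - 2γ > 0` and `2H > 0`. -/
lemma exists_lintegral_kernel_sq_le (T : ℝ) :
    ∃ M : ℝ≥0, ∀ t ∈ Icc 0 T, ∫⁻ τ, ‖kernel H t τ‖ₑ ^ 2 ∂(vol T) ≤ M := by
  obtain ⟨C, γ, hC, hγ0, hγ, hk⟩ := exists_abs_kernel_le hH0 hH1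
  set G := ∫ x in Ioo (0 : ℝ) 1, x ^ (1 - 2 * γ - 1) * (1 - x) ^ (2 * H - 1)
  have hG : 0 ≤ G := setIntegral_nonneg measurableSet_Ioo fun x hx =>
    mul_nonneg (Real.rpow_nonneg hx.1.le _) (Real.rpow_nonneg (sub_nonneg.2 hx.2.le) _)
  refine ⟨(C ^ 2 * T ^ (2 * H) * G).toNNReal, fun t ht => ?_⟩
  rcases ht.1.eq_or_lt with rfl | ht0
  · refine (lintegral_eq_zero_of_ae_eq_zero ?_).trans_le zero_le
    filter_upwards [ae_vol_pos T] with τ hτ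
    simp [kernel, hτ.not_gt]
  obtain ⟨hi, he⟩ := integrableOn_scaled_beta (u := 1 - 2 * γ) (v := 2 * H) (t := t)
    (by linarith) (by linarith) ht0
  have hpt : ∀ᵐ τ ∂(vol T), ‖kernel H t τ‖ₑ ^ 2 ≤ (Ioo 0 t).indicator (fun τ =>
      ENNReal.ofReal (C ^ 2 * t ^ (2 * H - 1) *
        ((τ / t) ^ (1 - 2 * γ - 1) * (1 - τ / t) ^ (2 * H - 1)))) τ := by
    filter_upwards [ae_vol_pos T] with τ hτ
    by_cases h : τ < t
    · have h0 : 0 ≤ 1 - τ / t := sub_nonneg.2 ((div_le_one ht0).2 h.le)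
      rw [indicator_of_mem (show τ ∈ Ioo 0 t from ⟨hτ, h⟩), ← ofReal_norm, ← ENNReal.ofReal_pow (norm_nonneg _)]
      refine ENNReal.ofReal_le_ofReal ?_
      rw [Real.norm_eq_abs]
      calc |kernel H t τ| ^ 2 ≤ (C * (t - τ) ^ (H - 1 / 2) * (t / τ) ^ γ) ^ 2 := by
            gcongr
            exact hk t τ hτ h
        _ = _ := by
          have e1 : t - τ = t * (1 - τ / t) := by field_simp
          have e2 : t / τ = (τ / t)⁻¹ := by rw [inv_div]
          rw [mul_pow, mul_pow, e1, e2, Real.mul_rpow ht0.le h0,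
            Real.inv_rpow (by positivity), ← Real.rpow_neg (by positivity), mul_pow,
            ← Real.rpow_mul_natCast ht0.le, ← Real.rpow_mul_natCast h0,
            ← Real.rpow_mul_natCast (by positivity : 0 ≤ τ / t),
            show (H - 1 / 2) * (2 : ℕ) = 2 * H - 1 by push_cast; ring,
            show -γ * (2 : ℕ) = 1 - 2 * γ - 1 by push_cast; ring]
          ring
    · simp [kernel, h]
  calc ∫⁻ τ, ‖kernel H t τ‖ₑ ^ 2 ∂(vol T)
      ≤ ∫⁻ τ, (Ioo 0 t).indicator (fun τ => ENNReal.ofReal (C ^ 2 * t ^ (2 * H - 1) *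
        ((τ / t) ^ (1 - 2 * γ - 1) * (1 - τ / t) ^ (2 * H - 1)))) τ ∂(vol T) :=
        lintegral_mono_ae hpt
    _ ≤ ∫⁻ τ, (Ioo 0 t).indicator (fun τ => ENNReal.ofReal (C ^ 2 * t ^ (2 * H - 1) *
        ((τ / t) ^ (1 - 2 * γ - 1) * (1 - τ / t) ^ (2 * H - 1)))) τ :=
        lintegral_mono' Measure.restrict_le_self le_rfl
    _ = ENNReal.ofReal (C ^ 2 * t ^ (2 * H) * G) := by
      rw [lintegral_indicator measurableSet_Ioo, ← ofReal_integral_eq_lintegral_ofReal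
        (hi.const_mul _), integral_const_mul, he]
      · congr 1
        have : t ^ (2 * H) = t ^ (2 * H - 1) * t := by
          rw [← Real.rpow_add_one ht0.ne']; ring_nf
        rw [this]
        ring
      · refine (ae_restrict_mem measurableSet_Ioo).mono fun x hx => ?_
        have : 0 ≤ 1 - x / t := sub_nonneg.2 ((div_le_one ht0).2 hx.2.le)
        have := hx.1
        dsimp
        positivity
    _ ≤ _ := by
      refine ENNReal.ofReal_le_ofReal ?_
      gcongr
      exact ht.2

lemma aestronglyMeasurable_kernel_right (T t : ℝ) :
    AEStronglyMeasurable (kernel H t) (vol T) := by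
  refine ((measurable_indicator_kernel hH0 hH1).comp
    measurable_prodMk_left).aestronglyMeasurable.congr (f := fun τ =>
      {p : ℝ × ℝ | 0 < p.2}.indicator (fun p => kernel H p.1 p.2) (t, τ)) ?_
  filter_upwards [ae_vol_pos T] with τ hτ
  simp [indicator, hτ]

lemma aestronglyMeasurable_kernel (T : ℝ) :
    AEStronglyMeasurable (fun p : ℝ × ℝ => kernel H p.1 p.2) ((vol T).prod (vol T)) := by
  refine (measurable_indicator_kernel hH0 hH1).aestronglyMeasurable.congr ?_
  filter_upwards [Measure.quasiMeasurePreserving_snd.ae (ae_vol_pos T)] with p hp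
  simp [indicator, hp]

lemma memLp_kernel_right {T t : ℝ} (ht : t ∈ Icc 0 T) : MemLp (kernel H t) 2 (vol T) := by
  obtain ⟨M, hM⟩ := exists_lintegral_kernel_sq_le hH0 hH1 T
  refine ⟨aestronglyMeasurable_kernel_right hH0 hH1 T t, ?_⟩
  rw [eLpNorm_lt_top_iff_lintegral_rpow_enorm_lt_top two_ne_zero ENNReal.ofNat_ne_top]
  simpa using (hM t ht).trans_lt ENNReal.coe_lt_top

lemma memLp_kernel (T : ℝ) :
    MemLp (fun p : ℝ × ℝ => kernel H p.1 p.2) 2 ((vol T).prod (vol T)) := by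
  obtain ⟨M, hM⟩ := exists_lintegral_kernel_sq_le hH0 hH1 T
  have hm := aestronglyMeasurable_kernel hH0 hH1 T
  refine ⟨hm, ?_⟩
  rw [eLpNorm_lt_top_iff_lintegral_rpow_enorm_lt_top two_ne_zero ENNReal.ofNat_ne_top]
  simp only [ENNReal.toReal_ofNat, ENNReal.rpow_ofNat]
  rw [lintegral_prod _ (hm.enorm.pow_const 2)]
  calc ∫⁻ t, ∫⁻ τ, ‖kernel H t τ‖ₑ ^ 2 ∂(vol T) ∂(vol T) ≤ ∫⁻ _, M ∂(vol T) :=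
        lintegral_mono_ae ((ae_restrict_mem measurableSet_Icc).mono hM)
    _ < ⊤ := by simp [ENNReal.mul_lt_top]

end

lemma integrable_mul_mul_kernel {α β : Type*} [MeasurableSpace α] [MeasurableSpace β]
    {μ : Measure α} {ν : Measure β} [SFinite μ] [SFinite ν] {k : α → β → ℝ}
    (hk : MemLp (fun p : α × β => k p.1 p.2) 2 (μ.prod ν))
    {f : α → ℝ} {g : β → ℝ} (hf : MemLp f 2 μ) (hg : MemLp g 2 ν) :
    Integrable (fun p : α × β => (f p.1 * g p.2) * k p.1 p.2) (μ.prod ν) := by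
  have hfg : MemLp (fun p : α × β => f p.1 * g p.2) 2 (μ.prod ν) := by
    refine (memLp_two_iff_integrable_sq (hf.1.comp_fst.mul hg.1.comp_snd)).2 ?_
    simpa only [Pi.mul_apply, mul_pow] using hf.integrable_sq.mul_prod hg.integrable_sq
  exact hfg.integrable_mul hk

/-- Fubini; the inner integral over `[0, T]` stops at `t` because the kernel vanishes beyond. -/
lemma specOperator_kernelOperator {T : ℝ} (q : HilbertBasis ℕ ℝ (Lp ℝ 2 (vol T)))
    {k : ℝ → ℝ → ℝ} (hk : MemLp (fun p : ℝ × ℝ => k p.1 p.2) 2 ((vol T).prod (vol T)))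
    (hk0 : ∀ t τ, t ≤ τ → k t τ = 0) (i j : ℕ) :
    specOperator q (kernelOperator k) i j = specKernel q k i j := by
  rw [specOperator, specKernel, integral_prod _ (integrable_mul_mul_kernel hk (Lp.memLp _)
    (Lp.memLp _))]
  refine setIntegral_congr_fun measurableSet_Icc fun t ht => ?_
  simp only [kernelOperator]
  rw [intervalIntegral.integral_of_le ht.1, ← integral_const_mul, integral_Icc_eq_integral_Ioc,
    ← setIntegral_eq_of_subset_of_forall_sdiff_eq_zero measurableSet_Ioc
      (Ioc_subset_Ioc_right ht.2) fun τ hτ => ?_]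
  · refine setIntegral_congr_fun measurableSet_Ioc fun τ _ => ?_
    ring
  · rw [hk0 t τ, zero_mul, mul_zero]
    by_contra h
    exact hτ.2 ⟨hτ.1.1, (not_le.1 h).le⟩

end SpectralFBM

namespace SpectralFBM

/-! ### The Wiener integral as an isometry -/

lemma norm_linearCombination_eq {ι E F : Type*} [NormedAddCommGroup E] [InnerProductSpace ℝ E]
    [NormedAddCommGroup F] [InnerProductSpace ℝ F] {v : ι → E} {w : ι → F} {s : Set ι}
    (h : ∀ i ∈ s, ∀ j ∈ s, inner ℝ (v i) (v j) = inner ℝ (w i) (w j))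
    {c : ι →₀ ℝ} (hc : c ∈ Finsupp.supported ℝ ℝ s) :
    ‖Finsupp.linearCombination ℝ v c‖ = ‖Finsupp.linearCombination ℝ w c‖ := by
  rw [Finsupp.mem_supported] at hc
  rw [← sq_eq_sq₀ (norm_nonneg _) (norm_nonneg _), ← real_inner_self_eq_norm_sq,
    ← real_inner_self_eq_norm_sq]
  simp only [Finsupp.linearCombination_apply, Finsupp.sum, sum_inner, inner_sum,
    real_inner_smul_left, real_inner_smul_right]
  exact Finset.sum_congr rfl fun i hi => Finset.sum_congr rfl fun j hj => by
    rw [h j (hc hj) i (hc hi)]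

/-- Here `K` will consist of formal step functions, several of which may represent one vector of
`E`. Equality of norms makes `f` depend only on `e c`, and the resulting map extends by density. -/
lemma exists_linearIsometry_of_dense {D E F : Type*} [AddCommGroup D] [Module ℝ D]
    [NormedAddCommGroup E] [NormedSpace ℝ E] [NormedAddCommGroup F] [NormedSpace ℝ F]
    [CompleteSpace F] {K : Submodule ℝ D} {e : D →ₗ[ℝ] E} {f : D →ₗ[ℝ] F}
    (hd : (K.map e).topologicalClosure = ⊤) (hn : ∀ c ∈ K, ‖f c‖ = ‖e c‖) :
    ∃ W : E →ₗᵢ[ℝ] F, ∀ c ∈ K, W (e c) = f c := by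
  have hd' : DenseRange (e.domRestrict K) := by
    rwa [DenseRange, ← LinearMap.coe_range, LinearMap.range_domRestrict,
      Submodule.dense_iff_topologicalClosure_eq_top]
  have hn' (c : K) : ‖f.domRestrict K c‖ = ‖e.domRestrict K c‖ := hn c c.2
  have hW (c : K) : (f.domRestrict K).extendOfNorm (e.domRestrict K) (e.domRestrict K c) =
      f.domRestrict K c :=
    LinearMap.extendOfNorm_eq hd' ⟨1, fun x => by rw [hn', one_mul]⟩ c
  refine ⟨⟨((f.domRestrict K).extendOfNorm (e.domRestrict K)).toLinearMap, fun x => ?_⟩,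
    fun c hc => hW ⟨c, hc⟩⟩
  refine hd'.induction_on x (isClosed_eq (ContinuousLinearMap.continuous _).norm continuous_norm)
    fun c => ?_
  change ‖(f.domRestrict K).extendOfNorm (e.domRestrict K) (e.domRestrict K c)‖ = _
  rw [hW, hn']

/-- The signed measure with density `f` vanishes on a π-system generating the Borel sets and on the
whole line, hence everywhere. -/
lemma ae_eq_zero_of_forall_setIntegral_Ioc {μ : Measure ℝ} [IsFiniteMeasure μ] {f : ℝ → ℝ}
    (hf : Integrable f μ) (h0 : ∫ x, f x ∂μ = 0) (h : ∀ a b, ∫ x in Ioc a b, f x ∂μ = 0) :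
    f =ᵐ[μ] 0 := by
  refine hf.ae_eq_of_withDensityᵥ_eq (integrable_zero _ _ _) ?_
  refine VectorMeasure.ext_of_generateFrom _ (fun s hs => ?_)
    (BorelSpace.measurable_eq.trans (borel_eq_generateFrom_Ioc ℝ)) (isPiSystem_Ioc id id) ?_
  · obtain ⟨a, b, -, rfl⟩ := hs
    rw [withDensityᵥ_apply hf measurableSet_Ioc, withDensityᵥ_apply (integrable_zero _ _ _)
      measurableSet_Ioc]
    simpa using h a b
  · rw [withDensityᵥ_apply hf .univ, withDensityᵥ_apply (integrable_zero _ _ _) .univ]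
    simpa using h0

/-- The indicator of the interval `(p.1, p.2]`. -/
noncomputable def stepInd (p : ℝ≥0 × ℝ≥0) : ℝ → ℝ :=
  (Ioc (p.1 : ℝ) (p.2 : ℝ)).indicator fun _ => 1

lemma memLp_stepInd (S : ℝ) (p : ℝ≥0 × ℝ≥0) : MemLp (stepInd p) 2 (vol S) :=
  memLp_indicator_const 2 measurableSet_Ioc 1 (Or.inr (measure_ne_top _ _))

/-- The step functions as elements of `L²([0, S])`. -/
noncomputable def stepLp (S : ℝ) : ((ℝ≥0 × ℝ≥0) →₀ ℝ) →ₗ[ℝ] Lp ℝ 2 (vol S) :=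
  Finsupp.linearCombination ℝ fun p => (memLp_stepInd S p).toLp

/-- The step functions whose intervals lie in `[0, S]`. -/
noncomputable def stepsUpTo (S : ℝ) : Submodule ℝ ((ℝ≥0 × ℝ≥0) →₀ ℝ) :=
  Finsupp.supported ℝ ℝ {p | p.1 ≤ p.2 ∧ (p.2 : ℝ) ≤ S}

lemma coeFn_linearCombination_toLp {ι α : Type*} [MeasurableSpace α] {μ : Measure α}
    {v : ι → α → ℝ} (hv : ∀ i, MemLp (v i) 2 μ) (c : ι →₀ ℝ) :
    Finsupp.linearCombination ℝ (fun i => (hv i).toLp) c =ᵐ[μ] fun x => c.sum fun i a => a * v i x := by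
  classical
  rw [Finsupp.linearCombination_apply, Finsupp.sum]
  have h1 := Lp.coeFn_finsetSum c.support fun i => c i • (hv i).toLp
  have h2 : ∀ᵐ x ∂μ, ∀ i ∈ c.support, (c i • (hv i).toLp : Lp ℝ 2 μ) x = c i * v i x := by
    rw [Filter.eventually_all_finset]
    intro i _
    filter_upwards [Lp.coeFn_smul (c i) (hv i).toLp, (hv i).coeFn_toLp] with x h3 h4
    rw [h3, Pi.smul_apply, h4, smul_eq_mul]
  filter_upwards [h1, h2] with x h1 h2
  rw [h1, Finsupp.sum]
  simp only [Finset.sum_apply]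
  exact Finset.sum_congr rfl h2

lemma coeFn_stepLp (S : ℝ) (c : (ℝ≥0 × ℝ≥0) →₀ ℝ) : stepLp S c =ᵐ[vol S] stepFun c :=
  coeFn_linearCombination_toLp (memLp_stepInd S) c

lemma inner_toLp {α : Type*} [MeasurableSpace α] {μ : Measure α} {f g : α → ℝ}
    (hf : MemLp f 2 μ) (hg : MemLp g 2 μ) :
    inner ℝ hf.toLp hg.toLp = ∫ x, f x * g x ∂μ := by
  rw [L2.inner_def]
  refine integral_congr_ae ?_
  filter_upwards [hf.coeFn_toLp, hg.coeFn_toLp] with x h1 h2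
  simp [h1, h2, mul_comm]

/-- A function orthogonal to all step functions has zero integral over every half-open interval,
hence is zero. -/
lemma stepFun_dense (S : ℝ) :
    ((stepsUpTo S).map (stepLp S)).topologicalClosure = ⊤ := by
  rw [Submodule.topologicalClosure_eq_top_iff, Submodule.eq_bot_iff]
  intro f hf
  have key (u v : ℝ≥0) (huv : u ≤ v) (hv : v ≤ S) : ∫ x in Ioc (u : ℝ) v, f x ∂(vol S) = 0 := by
    have := (Submodule.mem_orthogonal _ _).1 hf (stepLp S (Finsupp.single (u, v) 1))
      (Submodule.mem_map_of_mem (Finsupp.single_mem_supported ℝ 1 ⟨huv, hv⟩))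
    rw [stepLp, Finsupp.linearCombination_single, one_smul, ← Lp.toLp_coeFn f (Lp.memLp f),
      inner_toLp] at this
    rw [← this, ← integral_indicator measurableSet_Ioc]
    congr with x
    simp [stepInd, indicator]
  have hIoc (a b : ℝ) : ∫ x in Ioc a b, f x ∂(vol S) = 0 := by
    -- Only intervals inside `[0, S]` are admissible, so an arbitrary one is clipped, which changes
    -- nothing almost everywhere on `[0, S]`.
    have hc : ∫ x in Ioc a b, f x ∂(vol S) = ∫ x in Ioc (max a 0) (min b S), f x ∂(vol S) := by
      rw [← integral_indicator measurableSet_Ioc, ← integral_indicator measurableSet_Ioc]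
      refine integral_congr_ae ?_
      filter_upwards [ae_vol_pos S, ae_restrict_mem measurableSet_Icc] with x h1 h2
      have : x ∈ Ioc a b ↔ x ∈ Ioc (max a 0) (min b S) := by
        simp [h1, h2.2]
      by_cases hx : x ∈ Ioc a b
      · rw [indicator_of_mem hx, indicator_of_mem (this.1 hx)]
      · rw [indicator_of_notMem hx, indicator_of_notMem (mt this.2 hx)]
    rw [hc]
    rcases le_total (max a 0) (min b S) with h | h
    · have h0 : 0 ≤ max a 0 := le_max_right _ _
      exact key ⟨max a 0, h0⟩ ⟨min b S, h0.trans h⟩ h (min_le_right _ _)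
    · simp [Ioc_eq_empty_of_le h]
  have hint : Integrable f (vol S) := (Lp.memLp f).integrable one_le_two
  refine Lp.ext ((ae_eq_zero_of_forall_setIntegral_Ioc hint ?_ hIoc).trans (Lp.coeFn_zero _ _ _).symm)
  have h := hIoc 0 S
  rwa [Measure.restrict_restrict measurableSet_Ioc, inter_eq_left.2 Ioc_subset_Icc_self,
    ← integral_Icc_eq_integral_Ioc] at h

lemma integral_stepInd_mul_stepInd {S : ℝ} {p r : ℝ≥0 × ℝ≥0} (hp : p.2 ≤ S) :
    ∫ x, stepInd p x * stepInd r x ∂(vol S) = max 0 (min (p.2 : ℝ) r.2 - max (p.1 : ℝ) r.1) := by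
  have h : (fun x => stepInd p x * stepInd r x) =
      (Ioc (max (p.1 : ℝ) r.1) (min (p.2 : ℝ) r.2)).indicator fun _ => 1 := by
    ext x
    simp only [stepInd, ← inter_indicator_mul, Ioc_inter_Ioc, mul_one]
  rw [h, integral_indicator_const _ measurableSet_Ioc, smul_eq_mul, mul_one, measureReal_def,
    Measure.restrict_apply measurableSet_Ioc, inter_eq_left.2, Real.volume_Ioc,
    ENNReal.toReal_ofReal', max_comm]
  intro x hx
  exact ⟨((le_max_left _ _).trans' p.1.2).trans hx.1.le, (hx.2.trans (min_le_left _ _)).trans hp⟩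

section

variable {Ω : Type*} [MeasurableSpace Ω] {P : Measure Ω} {B : ℝ≥0 → Ω → ℝ}
  (hB : IsPreBrownianReal B P)

include hB

lemma memLp_increment (p : ℝ≥0 × ℝ≥0) : MemLp (fun ω => B p.2 ω - B p.1 ω) 2 P :=
  hB.isGaussianProcess.hasGaussianLaw_fun_sub.memLp_two

/-- The stochastic integrals of step functions as elements of `L²(P)`. -/
noncomputable def stepIntegralLp : ((ℝ≥0 × ℝ≥0) →₀ ℝ) →ₗ[ℝ] Lp ℝ 2 P :=
  Finsupp.linearCombination ℝ fun p => (memLp_increment hB p).toLp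

lemma coeFn_stepIntegralLp (c : (ℝ≥0 × ℝ≥0) →₀ ℝ) :
    stepIntegralLp hB c =ᵐ[P] stepIntegral B c :=
  coeFn_linearCombination_toLp (memLp_increment hB) c

/-- The covariance `min s t` yields an alternating sum of four minima, which is the length of the
overlap of the two intervals. This matches the inner product of their indicators and gives the
isometry. -/
lemma integral_increment_mul_increment {p r : ℝ≥0 × ℝ≥0} (hp : p.1 ≤ p.2) (hr : r.1 ≤ r.2) :
    ∫ ω, (B p.2 ω - B p.1 ω) * (B r.2 ω - B r.1 ω) ∂P =
      max 0 (min (p.2 : ℝ) r.2 - max (p.1 : ℝ) r.1) := by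
  have := hB.isGaussianProcess.isProbabilityMeasure
  have hm (t) : MemLp (B t) 2 P := (hB.isGaussianProcess.hasGaussianLaw_eval t).memLp_two
  have h0 (s t : ℝ≥0) : ∫ ω, (B s ω - B t ω) ∂P = 0 := by
    rw [integral_sub (hB.integrable_eval s) (hB.integrable_eval t), hB.integral_eval,
      hB.integral_eval, sub_zero]
  have hcov := covariance_eq_sub (memLp_increment hB p) (memLp_increment hB r)
  rw [h0, zero_mul, sub_zero] at hcov
  change cov[_, _; P] = ∫ ω, (B p.2 ω - B p.1 ω) * (B r.2 ω - B r.1 ω) ∂P at hcov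
  rw [← hcov, covariance_fun_sub_fun_sub (hm _) (hm _) (hm _) (hm _)]
  simp only [hB.covariance_fun_eval, NNReal.coe_min]
  have hp' : (p.1 : ℝ) ≤ p.2 := hp
  have hr' : (r.1 : ℝ) ≤ r.2 := hr
  grind

lemma norm_stepIntegralLp {S : ℝ} {c : (ℝ≥0 × ℝ≥0) →₀ ℝ} (hc : c ∈ stepsUpTo S) :
    ‖stepIntegralLp hB c‖ = ‖stepLp S c‖ := by
  refine norm_linearCombination_eq (fun p hp r hr => ?_) hc
  rw [inner_toLp, inner_toLp, integral_increment_mul_increment hB hp.1 hr.1,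
    integral_stepInd_mul_stepInd hp.2]

theorem exists_wienerIsometry (S : ℝ) :
    ∃ W : Lp ℝ 2 (vol S) →ₗᵢ[ℝ] Lp ℝ 2 P,
      ∀ c ∈ stepsUpTo S, W (stepLp S c) = stepIntegralLp hB c := by
  exact exists_linearIsometry_of_dense (stepFun_dense S) fun c hc => norm_stepIntegralLp hB hc

end

end SpectralFBM

/-! ### Gaussian law and independence of Wiener integrals -/

namespace SpectralFBM

lemma tendsto_toLp_iff {α : Type*} [MeasurableSpace α] {μ : Measure α} {ι : Type*}
    {l : Filter ι} {g : ι → Lp ℝ 2 μ} {G : ι → α → ℝ} (hg : ∀ n, g n =ᵐ[μ] G n) {f : α → ℝ} (hf : MemLp f 2 μ) :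
    Tendsto g l (𝓝 hf.toLp) ↔
      Tendsto (fun n => eLpNorm (fun x => G n x - f x) 2 μ) l (𝓝 0) := by
  rw [Lp.tendsto_Lp_iff_tendsto_eLpNorm']
  refine tendsto_congr fun n => eLpNorm_congr_ae ?_
  filter_upwards [hg n, hf.coeFn_toLp] with x h1 h2
  simp [h1, h2]

/-- From `|e^(ix) - e^(iy)| ≤ |x - y|` and `L¹ ≤ L²` on a probability space. It carries the
characteristic function from step functions to their limits. -/
lemma lipschitzWith_integral_cexp {Ω : Type*} [MeasurableSpace Ω] {P : Measure Ω}
    [IsProbabilityMeasure P] :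
    LipschitzWith 1 fun X : Lp ℝ 2 P => ∫ ω, Complex.exp (Complex.I * (X ω : ℂ)) ∂P := by
  have hi (X : Lp ℝ 2 P) : Integrable (fun ω => Complex.exp (Complex.I * (X ω : ℂ))) P := by
    refine Integrable.of_bound (C := 1) ?_ (ae_of_all _ fun ω => ?_)
    · have := (Lp.aestronglyMeasurable X).aemeasurable
      exact AEMeasurable.aestronglyMeasurable (by fun_prop)
    · rw [mul_comm, Complex.norm_exp_ofReal_mul_I]
  refine LipschitzWith.mk_one fun X Y => ?_
  rw [dist_eq_norm, dist_eq_norm, ← integral_sub (hi X) (hi Y)]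
  have hXY : MemLp (X - Y : Lp ℝ 2 P) 2 P := Lp.memLp _
  calc ‖∫ ω, Complex.exp (Complex.I * (X ω : ℂ)) - Complex.exp (Complex.I * (Y ω : ℂ)) ∂P‖
      ≤ ∫ ω, ‖(X - Y : Lp ℝ 2 P) ω‖ ∂P := by
        refine norm_integral_le_of_norm_le (hXY.integrable one_le_two).norm ?_
        filter_upwards [Lp.coeFn_sub X Y] with ω h
        have e : Complex.exp (Complex.I * (X ω : ℂ)) - Complex.exp (Complex.I * (Y ω : ℂ)) =
            Complex.exp ((Y ω : ℂ) * Complex.I) *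
              (Complex.exp (Complex.I * ((X ω - Y ω : ℝ) : ℂ)) - 1) := by
          rw [mul_sub, ← Complex.exp_add, mul_one, mul_comm Complex.I (Y ω : ℂ)]
          push_cast
          ring_nf
        rw [e, norm_mul, Complex.norm_exp_ofReal_mul_I, one_mul, h]
        exact Real.norm_exp_I_mul_ofReal_sub_one_le
    _ ≤ ‖X - Y‖ := by
      rw [integral_norm_eq_lintegral_enorm hXY.1, ← eLpNorm_one_eq_lintegral_enorm, Lp.norm_def]
      exact ENNReal.toReal_mono hXY.2.ne (eLpNorm_le_eLpNorm_of_exponent_le one_le_two hXY.1)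

section

variable {Ω : Type*} [MeasurableSpace Ω] {P : Measure Ω} {B : ℝ≥0 → Ω → ℝ}
  {hB : IsPreBrownianReal B P} {S : ℝ} {W : Lp ℝ 2 (vol S) →ₗᵢ[ℝ] Lp ℝ 2 P}
  (hW : ∀ c ∈ stepsUpTo S, W (stepLp S c) = stepIntegralLp hB c)

include hW

/-- Replaces the definition through approximating sequences by an equation for `W`. Continuity of
`W` makes the limit independent of the sequence, and density supplies one. -/
theorem isWienerIntegral_iff {f : ℝ → ℝ} {X : Ω → ℝ} (hf : MemLp f 2 (vol S))
    (hX : MemLp X 2 P) : IsWienerIntegral B P S f X ↔ W hf.toLp = hX.toLp := by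
  constructor
  · rintro ⟨-, -, c, hc, h1, h2⟩
    have hc' (n) : c n ∈ stepsUpTo S := fun p hp => hc n p hp
    rw [← tendsto_toLp_iff (fun n => coeFn_stepLp S (c n)) hf] at h1
    rw [← tendsto_toLp_iff (fun n => coeFn_stepIntegralLp hB (c n)) hX] at h2
    refine tendsto_nhds_unique ((W.continuous.tendsto _).comp h1) ?_
    simpa only [Function.comp_def, hW _ (hc' _)] using h2
  · intro h
    have hm : hf.toLp ∈ closure (((stepsUpTo S).map (stepLp S) : Submodule ℝ _) : Set _) := by
      rw [← Submodule.topologicalClosure_coe, stepFun_dense]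
      trivial
    obtain ⟨g, hg, hlim⟩ := mem_closure_iff_seq_limit.1 hm
    choose c hc hcg using fun n => (Submodule.mem_map.1 (hg n))
    refine ⟨hf, hX, c, fun n p hp => hc n hp, ?_, ?_⟩
    · rw [← tendsto_toLp_iff (fun n => coeFn_stepLp S (c n)) hf]
      simpa only [hcg] using hlim
    · rw [← tendsto_toLp_iff (fun n => coeFn_stepIntegralLp hB (c n)) hX, ← h]
      simpa only [Function.comp_def, ← hcg, hW _ (hc _)] using (W.continuous.tendsto _).comp hlim

/-- Both sides are continuous in `f`, and for a step function `W f` is a centred Gaussian of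
variance `‖f‖²`. The value at frequency `1` suffices, since `f` may be rescaled. -/
lemma integral_cexp_wienerIsometry (f : Lp ℝ 2 (vol S)) :
    ∫ ω, Complex.exp (Complex.I * (W f ω : ℂ)) ∂P = Complex.exp (-(‖f‖ ^ 2 / 2 : ℝ)) := by
  have := hB.isGaussianProcess.isProbabilityMeasure
  have hd : Dense (((stepsUpTo S).map (stepLp S) : Submodule ℝ _) : Set (Lp ℝ 2 (vol S))) := by
    rw [Submodule.dense_iff_topologicalClosure_eq_top, stepFun_dense]
  refine hd.induction (P := fun f => ∫ ω, Complex.exp (Complex.I * (W f ω : ℂ)) ∂P =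
    Complex.exp (-(‖f‖ ^ 2 / 2 : ℝ))) ?_ (isClosed_eq
      (lipschitzWith_integral_cexp.continuous.comp W.continuous) (by fun_prop)) f
  rintro _ ⟨c, hc, rfl⟩
  have hG : HasGaussianLaw (stepIntegralLp hB c) P := by
    have h : IsGaussianProcess (fun (p : ℝ≥0 × ℝ≥0) ω => B p.2 ω - B p.1 ω) P := by
      classical
      refine hB.isGaussianProcess.of_isGaussianProcess fun p => ⟨{p.1, p.2},
        { toFun x := x ⟨p.2, by simp⟩ - x ⟨p.1, by simp⟩
          map_add' x y := by simp; abel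
          map_smul' c x := by simp; ring }, by simp⟩
    exact (h.smul c).hasGaussianLaw_fun_sum (I := c.support) |>.congr
      (coeFn_stepIntegralLp hB c).symm
  have h0 : ∫ ω, stepIntegralLp hB c ω ∂P = 0 := by
    rw [integral_congr_ae (coeFn_stepIntegralLp hB c)]
    simp only [stepIntegral, Finsupp.sum]
    rw [integral_finsetSum _ fun p _ =>
      ((memLp_increment hB p).integrable one_le_two).const_mul _]
    refine Finset.sum_eq_zero fun p _ => ?_
    rw [integral_const_mul, integral_sub (hB.integrable_eval _) (hB.integrable_eval _),
      hB.integral_eval, hB.integral_eval, sub_zero, mul_zero]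
  have hv : Var[stepIntegralLp hB c; P] = ‖stepLp S c‖ ^ 2 := by
    rw [variance_of_integral_eq_zero (Lp.aestronglyMeasurable _).aemeasurable h0,
      ← norm_stepIntegralLp hB hc, ← real_inner_self_eq_norm_sq, L2.inner_def]
    simp [sq]
  have hchar : charFun (P.map (stepIntegralLp hB c)) 1 = _ :=
    congrArg (fun μ => charFun μ (1 : ℝ)) hG.map_eq_gaussianReal
  rw [charFun_gaussianReal, h0, hv, charFun_apply_real, integral_map hG.aemeasurable
    (by fun_prop), Real.coe_toNNReal _ (sq_nonneg _)] at hchar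
  rw [hW c hc]
  convert hchar using 2
  · simp [mul_comm]
  · push_cast
    ring

theorem hasLaw_wienerIsometry (f : Lp ℝ 2 (vol S)) :
    HasLaw (W f) (gaussianReal 0 (‖f‖₊ ^ 2)) P := by
  have := hB.isGaussianProcess.isProbabilityMeasure
  have hm : AEMeasurable (W f) P := (Lp.aestronglyMeasurable _).aemeasurable
  have := Measure.isProbabilityMeasure_map hm
  refine ⟨hm, Measure.ext_of_charFun (funext fun s => ?_)⟩
  have h := integral_cexp_wienerIsometry hW (s • f)
  rw [charFun_gaussianReal, charFun_apply_real, integral_map hm (by fun_prop)]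
  calc ∫ ω, Complex.exp (s * (W f ω : ℂ) * Complex.I) ∂P
      = ∫ ω, Complex.exp (Complex.I * (W (s • f) ω : ℂ)) ∂P := by
        refine integral_congr_ae ?_
        rw [map_smul]
        filter_upwards [Lp.coeFn_smul s (W f)] with ω h
        simp [h, mul_comm]
    _ = _ := by
        rw [h, norm_smul, mul_pow, Real.norm_eq_abs, sq_abs]
        push_cast
        simp [mul_comm]

/-- A linear functional of finitely many `W (v i)` is again a value of `W`, so the vector is jointly
Gaussian, and orthogonality makes it uncorrelated. -/
theorem iIndepFun_wienerIsometry {v : ℕ → Lp ℝ 2 (vol S)} (hv : Orthonormal ℝ v) :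
    iIndepFun (fun i => ⇑(W (v i))) P := by
  have := hB.isGaussianProcess.isProbabilityMeasure
  rw [iIndepFun_iff_finset]
  intro s
  have hL : HasGaussianLaw (fun ω (i : s) => W (v i) ω) P := by
    have hm : AEMeasurable (fun ω (i : s) => W (v i) ω) P :=
      aemeasurable_pi_lambda _ fun i => (Lp.aestronglyMeasurable _).aemeasurable
    refine ⟨isGaussian_of_isGaussian_map fun L => ?_⟩
    rw [AEMeasurable.map_map_of_aemeasurable (by fun_prop) hm]
    have hae : ⇑(W (∑ i : s, L (Pi.single i 1) • v i)) =ᵐ[P] L ∘ fun ω (i : s) => W (v i) ω := by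
      rw [map_sum]
      have h2 : ∀ᵐ ω ∂P, ∀ i : s, W (L (Pi.single i 1) • v i) ω = L (Pi.single i 1) * W (v i) ω := by
        rw [ae_all_iff]
        intro i
        rw [map_smul]
        filter_upwards [Lp.coeFn_smul (L (Pi.single i 1)) (W (v i))] with ω h
        simp [h]
      filter_upwards [Lp.coeFn_finsetSum Finset.univ fun i : s => W (L (Pi.single i 1) • v i),
        h2] with ω h1 h2
      rw [h1, Finset.sum_apply, Function.comp_apply,
        ← Finset.univ_sum_single fun i : s => W (v i) ω, map_sum]
      refine Finset.sum_congr rfl fun i _ => ?_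
      rw [h2, mul_comm, ← smul_eq_mul, ← map_smul, ← Pi.single_smul', smul_eq_mul, mul_one]
    rw [← Measure.map_congr hae, (hasLaw_wienerIsometry hW _).map_eq]
    infer_instance
  refine hL.iIndepFun_of_covariance_eq_zero fun i j hij => ?_
  have h0 (i : ℕ) : ∫ ω, W (v i) ω ∂P = 0 := by
    rw [(hasLaw_wienerIsometry hW (v i)).integral_eq, integral_id_gaussianReal]
  rw [covariance_eq_sub (Lp.memLp _) (Lp.memLp _), h0, zero_mul, sub_zero]
  have : inner ℝ (v i) (v j) = 0 := hv.2 (Subtype.coe_injective.ne hij)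
  rw [← W.inner_map_map, L2.inner_def] at this
  simpa [mul_comm] using this

end

end SpectralFBM

namespace SpectralFBM

/-! ### Almost sure convergence of series of independent random variables -/

lemma coeFn_sum_smul {α : Type*} [MeasurableSpace α] {μ : Measure α} (a : ℕ → ℝ)
    (V : ℕ → Lp ℝ 2 μ) (s : Finset ℕ) :
    ⇑(∑ j ∈ s, a j • V j) =ᵐ[μ] fun x => ∑ j ∈ s, a j * V j x := by
  have h2 : ∀ᵐ x ∂μ, ∀ j, (a j • V j : Lp ℝ 2 μ) x = a j * V j x := by
    rw [ae_all_iff]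
    intro j
    filter_upwards [Lp.coeFn_smul (a j) (V j)] with x h
    simp [h]
  filter_upwards [Lp.coeFn_finsetSum s fun j => a j • V j, h2] with x h1 h2
  rw [h1, Finset.sum_apply]
  exact Finset.sum_congr rfl fun j _ => h2 j

/-- Martingale convergence gives some almost sure limit; a subsequence of the `L²`-convergent
partial sums identifies it as `X`. -/
theorem ae_tendsto_sum_of_hasSum {Ω : Type*} [MeasurableSpace Ω] {P : Measure Ω}
    {V : ℕ → Lp ℝ 2 P} (hV : iIndepFun (fun i => ⇑(V i)) P) (h0 : ∀ i, ∫ ω, V i ω ∂P = 0)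
    {a : ℕ → ℝ} {X : Lp ℝ 2 P} (hX : HasSum (fun j => a j • V j) X) :
    ∀ᵐ ω ∂P, Tendsto (fun n => ∑ j ∈ Finset.range n, a j * V j ω) atTop (𝓝 (X ω)) := by
  have := hV.isProbabilityMeasure
  have hm (i : ℕ) : StronglyMeasurable (V i) := Lp.stronglyMeasurable _
  have hint (i : ℕ) : Integrable (V i) P := (Lp.memLp _).integrable one_le_two
  -- The sum runs through `j = n`, in step with the natural filtration, so the next increment
  -- involves only `V (n + 1)`, which is independent of the past.
  set M : ℕ → Ω → ℝ := fun n ω => ∑ j ∈ Finset.range (n + 1), a j * V j ω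
  have hlim : Tendsto (fun n => ∑ j ∈ Finset.range (n + 1), a j • V j) atTop (𝓝 X) :=
    (tendsto_add_atTop_iff_nat 1).2 hX.tendsto_sum_nat
  have hM (n : ℕ) : ⇑(∑ j ∈ Finset.range (n + 1), a j • V j) =ᵐ[P] M n :=
    coeFn_sum_smul a V _
  have hmart : Martingale M (Filtration.natural _ hm) P := by
    refine martingale_of_condExp_sub_eq_zero_nat (fun n => ?_)
      (fun n => integrable_finsetSum _ fun j _ => (hint j).const_mul _) fun n => ?_
    · refine Finset.stronglyMeasurable_fun_sum _ fun j hj => ?_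
      refine StronglyMeasurable.const_mul ?_ _
      exact (Filtration.stronglyAdapted_natural hm j).mono
        ((Filtration.natural _ hm).mono (Nat.lt_succ_iff.1 (Finset.mem_range.1 hj)))
    · have e : M (n + 1) - M n = a (n + 1) • ⇑(V (n + 1)) := by
        ext ω
        simp [M, Finset.sum_range_succ _ (n + 1)]
      rw [e]
      refine (condExp_smul _ _ _).trans ?_
      filter_upwards [hV.condExp_natural_ae_eq_of_lt hm n.lt_succ_self] with ω h
      rw [Pi.smul_apply, h, h0, smul_zero, Pi.zero_apply]
  obtain ⟨R, hR⟩ := hlim.norm.bddAbove_range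
  have hbdd (n : ℕ) : eLpNorm (M n) 1 P ≤ R.toNNReal := by
    rw [← eLpNorm_congr_ae (hM n)]
    refine (eLpNorm_le_eLpNorm_of_exponent_le one_le_two (Lp.aestronglyMeasurable _)).trans ?_
    rw [← ENNReal.ofReal_toReal (Lp.eLpNorm_ne_top _), ← Lp.norm_def]
    exact ENNReal.ofReal_le_ofReal (hR ⟨n, rfl⟩)
  obtain ⟨ns, hns, hsub⟩ := (tendstoInMeasure_of_tendsto_Lp hlim).exists_seq_tendsto_ae
  filter_upwards [hmart.submartingale.exists_ae_tendsto_of_bdd hbdd, hsub, ae_all_iff.2 hM]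
    with ω ⟨c, hc⟩ h2 h3
  rw [← tendsto_add_atTop_iff_nat 1]
  simp only [h3] at h2
  rwa [tendsto_nhds_unique h2 (hc.comp hns.tendsto_atTop)]

end SpectralFBM

namespace SpectralFBM

/-! ### Wiener integrals on subintervals -/

lemma eLpNorm_vol_eq {s S : ℝ} (hs : s ≤ S) {g : ℝ → ℝ} (hg : ∀ x, s < x → g x = 0) :
    eLpNorm g 2 (vol S) = eLpNorm g 2 (vol s) := by
  have h : vol s = (vol S).restrict (Icc 0 s) := by
    rw [Measure.restrict_restrict measurableSet_Icc, inter_eq_left.2 (Icc_subset_Icc_right hs)]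
  rw [h, ← eLpNorm_indicator_eq_eLpNorm_restrict (f := g) (μ := vol S) measurableSet_Icc]
  refine eLpNorm_congr_ae ?_
  filter_upwards [ae_restrict_mem measurableSet_Icc] with x hx
  by_cases hxs : x ≤ s
  · rw [indicator_of_mem (show x ∈ Icc 0 s from ⟨hx.1, hxs⟩)]
  · rw [hg x (not_le.1 hxs), indicator_of_notMem fun h => hxs h.2]

section

variable {Ω : Type*} [MeasurableSpace Ω] {P : Measure Ω} {B : ℝ≥0 → Ω → ℝ}

lemma IsWienerIntegral.congr {S : ℝ} {f : ℝ → ℝ} {X Y : Ω → ℝ} (h : IsWienerIntegral B P S f X)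
    (hXY : X =ᵐ[P] Y) : IsWienerIntegral B P S f Y := by
  obtain ⟨hf, hX, c, hc, h1, h2⟩ := h
  refine ⟨hf, (memLp_congr_ae hXY).1 hX, c, hc, h1, h2.congr fun n => eLpNorm_congr_ae ?_⟩
  filter_upwards [hXY] with ω h
  rw [h]

/-- Lets one isometry on `[0, T]` handle all the integrals over `[0, t]` that define the process. -/
lemma IsWienerIntegral.mono {s S : ℝ} (hs : s ≤ S) {f : ℝ → ℝ} {X : Ω → ℝ}
    (h : IsWienerIntegral B P s f X) (hf : MemLp f 2 (vol S)) (hf0 : ∀ x, s < x → f x = 0) :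
    IsWienerIntegral B P S f X := by
  obtain ⟨-, hX, c, hc, h1, h2⟩ := h
  refine ⟨hf, hX, c, fun n p hp => ⟨(hc n p hp).1, (hc n p hp).2.trans hs⟩,
    h1.congr fun n => ?_, h2⟩
  refine (eLpNorm_vol_eq hs fun x hx => ?_).symm
  rw [hf0 x hx, sub_zero, stepFun, Finsupp.sum]
  refine Finset.sum_eq_zero fun p hp => ?_
  rw [indicator_of_notMem fun h : x ∈ Ioc _ _ => (h.2.trans (hc n p hp).2).not_gt hx, mul_zero]

lemma isWienerIntegral_wienerIntegral (hB : IsPreBrownianReal B P) {S : ℝ} {f : ℝ → ℝ}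
    (hf : MemLp f 2 (vol S)) : IsWienerIntegral B P S f (wienerIntegral B P S f) := by
  obtain ⟨W, hW⟩ := exists_wienerIsometry hB S
  have h : ∃ X, IsWienerIntegral B P S f X :=
    ⟨W hf.toLp, (isWienerIntegral_iff hW hf (Lp.memLp _)).2 (Lp.toLp_coeFn _ _).symm⟩
  rw [wienerIntegral, dif_pos h]
  exact h.choose_spec

end

/-! ### Integrals of square-integrable processes -/

lemma lintegral_enorm_sq {α : Type*} [MeasurableSpace α] (μ : Measure α) (f : α → ℝ) :
    ∫⁻ x, ‖f x‖ₑ ^ 2 ∂μ = eLpNorm f 2 μ ^ 2 := by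
  have h := eLpNorm_nnreal_pow_eq_lintegral (f := f) (μ := μ) (p := 2) two_ne_zero
  simpa using h.symm

section

variable {α Ω : Type*} [MeasurableSpace α] [MeasurableSpace Ω] {μ : Measure α} {P : Measure Ω}
  [SFinite μ] [IsProbabilityMeasure P] {Z : α → Ω → ℝ}
  (hZ : MemLp (fun p : α × Ω => Z p.1 p.2) 2 (μ.prod P))

include hZ

lemma ae_memLp_section : ∀ᵐ ω ∂P, MemLp (fun t => Z t ω) 2 μ := by
  filter_upwards [hZ.1.prod_swap.prodMk_left, hZ.integrable_sq.prod_left_ae] with ω h1 h2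
  exact (memLp_two_iff_integrable_sq h1).2 h2

/-- Cauchy–Schwarz in `t` for almost every path, then integration over `Ω`. -/
lemma memLp_integral_mul {f : α → ℝ} (hf : MemLp f 2 μ) :
    MemLp (fun ω => ∫ t, f t * Z t ω ∂μ) 2 P := by
  have hm : AEStronglyMeasurable (fun ω => ∫ t, f t * Z t ω ∂μ) P :=
    (hf.1.comp_fst.mul hZ.1).prod_swap.integral_prod_right'
  rw [memLp_two_iff_integrable_sq hm]
  refine ((hZ.integrable_sq.integral_prod_right).const_mul (‖hf.toLp‖ ^ 2)).mono' (hm.pow 2) ?_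
  filter_upwards [ae_memLp_section hZ] with ω hω
  have h := abs_real_inner_le_norm hf.toLp hω.toLp
  rw [inner_toLp] at h
  have h2 : ‖hω.toLp‖ ^ 2 = ∫ t, Z t ω ^ 2 ∂μ := by
    rw [← real_inner_self_eq_norm_sq, inner_toLp]
    simp only [sq]
  rw [← h2, ← mul_pow, Real.norm_eq_abs, abs_pow]
  exact pow_le_pow_left₀ (abs_nonneg _) h 2

lemma integral_integral_mul_mul {f : α → ℝ} (hf : MemLp f 2 μ) {Y : Ω → ℝ} (hY : MemLp Y 2 P) :
    ∫ ω, (∫ t, f t * Z t ω ∂μ) * Y ω ∂P = ∫ t, f t * ∫ ω, Z t ω * Y ω ∂P ∂μ := by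
  have h := integral_integral_swap (f := fun t ω => f t * Y ω * Z t ω)
    (integrable_mul_mul_kernel hZ hf hY)
  calc _ = ∫ ω, ∫ t, f t * Y ω * Z t ω ∂μ ∂P := by
        simp only [← integral_mul_const, mul_right_comm]
    _ = ∫ t, ∫ ω, f t * Y ω * Z t ω ∂P ∂μ := h.symm
    _ = _ := by
        simp only [← integral_const_mul]
        congr with t
        congr with ω
        ring

lemma inner_integral_mul {f : α → ℝ} (hf : MemLp f 2 μ) (Y : Lp ℝ 2 P) :
    inner ℝ (memLp_integral_mul hZ hf).toLp Y = ∫ t, f t * ∫ ω, Z t ω * Y ω ∂P ∂μ := by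
  have h := inner_toLp (memLp_integral_mul hZ hf) (Lp.memLp Y)
  rw [Lp.toLp_coeFn] at h
  rw [h, integral_integral_mul_mul hZ hf (Lp.memLp Y)]

end

end SpectralFBM

namespace SpectralFBM

/-! ### Expansion of a process of Wiener integrals -/

section

variable {Ω : Type*} [MeasurableSpace Ω] {P : Measure Ω} {T : ℝ}
  {W : Lp ℝ 2 (vol T) →ₗᵢ[ℝ] Lp ℝ 2 P} {k : ℝ → ℝ → ℝ} {Z : ℝ → Ω → ℝ}
  (hk : ∀ t ∈ Icc 0 T, MemLp (k t) 2 (vol T))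
  (hWZ : ∀ t (ht : t ∈ Icc 0 T), W (hk t ht).toLp =ᵐ[P] Z t)

include hWZ

lemma inner_toLp_wiener {t : ℝ} (ht : t ∈ Icc 0 T) (Y : Lp ℝ 2 P) :
    ∫ ω, Z t ω * Y ω ∂P = inner ℝ (W (hk t ht).toLp) Y := by
  rw [L2.inner_def]
  refine integral_congr_ae ?_
  filter_upwards [hWZ t ht] with ω h
  simp [h, mul_comm]

variable [IsProbabilityMeasure P] (hZ : MemLp (fun p : ℝ × Ω => Z p.1 p.2) 2 ((vol T).prod P))

/-- `W W*` is the orthogonal projection onto the range of `W`. It fixes each `Z t = W k_t`, so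
replacing `Y` by `W W* Y` changes no pairing `⟨Z t, Y⟩`, nor their integral against `f`. -/
lemma wiener_adjoint_integral_mul {f : ℝ → ℝ} (hf : MemLp f 2 (vol T)) :
    W (W.toContinuousLinearMap.adjoint (memLp_integral_mul hZ hf).toLp) =
      (memLp_integral_mul hZ hf).toLp := by
  set A := W.toContinuousLinearMap.adjoint
  have hA (x : Lp ℝ 2 (vol T)) (Y : Lp ℝ 2 P) : inner ℝ (W x) Y = inner ℝ x (A Y) :=
    (ContinuousLinearMap.adjoint_inner_right W.toContinuousLinearMap x Y).symm
  refine ext_inner_right ℝ fun Y => ?_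
  calc inner ℝ (W (A (memLp_integral_mul hZ hf).toLp)) Y
      = inner ℝ (memLp_integral_mul hZ hf).toLp (W (A Y)) := by
        rw [hA, real_inner_comm, ← hA, real_inner_comm]
    _ = inner ℝ (memLp_integral_mul hZ hf).toLp Y := by
        rw [inner_integral_mul hZ hf, inner_integral_mul hZ hf]
        refine setIntegral_congr_fun measurableSet_Icc fun t ht => ?_
        rw [inner_toLp_wiener hk hWZ ht, inner_toLp_wiener hk hWZ ht, W.inner_map_map, hA]

theorem hasSum_specKernel (q : HilbertBasis ℕ ℝ (Lp ℝ 2 (vol T)))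
    (hk2 : MemLp (fun p : ℝ × ℝ => k p.1 p.2) 2 ((vol T).prod (vol T))) (i : ℕ) :
    HasSum (fun j => specKernel q k i j • W (q j))
      (memLp_integral_mul hZ (Lp.memLp (q i))).toLp := by
  set X := (memLp_integral_mul hZ (Lp.memLp (q i))).toLp
  have hX : W (W.toContinuousLinearMap.adjoint X) = X :=
    wiener_adjoint_integral_mul hk hWZ hZ (Lp.memLp (q i))
  have h := (q.hasSum_repr (W.toContinuousLinearMap.adjoint X)).map W W.continuous
  rw [hX] at h
  convert h using 2 with j
  rw [Function.comp_apply, map_smul, q.repr_apply_apply, ← W.inner_map_map, hX, real_inner_comm]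
  congr 1
  rw [inner_integral_mul hZ (Lp.memLp _), specKernel,
    integral_prod _ (integrable_mul_mul_kernel hk2 (Lp.memLp _) (Lp.memLp _))]
  refine setIntegral_congr_fun measurableSet_Icc fun t ht => ?_
  dsimp only
  rw [inner_toLp_wiener hk hWZ ht, W.inner_map_map]
  have := inner_toLp (hk t ht) (Lp.memLp (q j))
  rw [Lp.toLp_coeFn] at this
  rw [this, ← integral_const_mul]
  congr with τ
  ring

end

end SpectralFBM

/-! ### The spectral representation -/

theorem theorem1 {Ω : Type*} [MeasurableSpace Ω] (P : Measure Ω) [IsProbabilityMeasure P]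
    (B : ℝ≥0 → Ω → ℝ) (hB : IsBrownianReal B P)
    (H : ℝ) (hH0 : 0 < H) (hH1 : H < 1) (T : ℝ) (hT : 0 < T)
    (q : HilbertBasis ℕ ℝ (Lp ℝ 2 (SpectralFBM.vol T)))
    (BH : ℝ → Ω → ℝ)
    (hBH_meas : AEStronglyMeasurable (fun p : ℝ × Ω => BH p.1 p.2) ((SpectralFBM.vol T).prod P))
    (hBH : ∀ t ∈ Icc (0 : ℝ) T,
      BH t =ᵐ[P] SpectralFBM.wienerIntegral B P t (SpectralFBM.kernel H t)) :
    -- the Wiener integrals that define the process exist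
    (∀ t ∈ Icc (0 : ℝ) T, SpectralFBM.IsWienerIntegral B P t (SpectralFBM.kernel H t) (BH t)) ∧
    -- the coefficients of the white noise are independent and standard normal
    (∀ i, SpectralFBM.IsWienerIntegral B P T (q i) (SpectralFBM.specWhiteNoise q B P i)) ∧
    iIndepFun (SpectralFBM.specWhiteNoise q B P) P ∧
    (∀ i, HasLaw (SpectralFBM.specWhiteNoise q B P i) (gaussianReal 0 1) P) ∧
    -- the spectral characteristic of the operator is that of its square-integrable kernel
    MemLp (fun p : ℝ × ℝ => SpectralFBM.kernel H p.1 p.2) 2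
      ((SpectralFBM.vol T).prod (SpectralFBM.vol T)) ∧
    (∀ i j, SpectralFBM.specOperator q (SpectralFBM.kernelOperator (SpectralFBM.kernel H)) i j =
      SpectralFBM.specKernel q (SpectralFBM.kernel H) i j) ∧
    -- the paths are square-integrable
    (∀ᵐ ω ∂P, MemLp (fun t => BH t ω) 2 (SpectralFBM.vol T)) ∧
    -- the matrix identity, with the series converging almost surely and in mean square
    (∀ᵐ ω ∂P, ∀ i, Tendsto
      (fun n : ℕ => ∑ j ∈ Finset.range n, SpectralFBM.specKernel q (SpectralFBM.kernel H) i j *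
        SpectralFBM.specWhiteNoise q B P j ω)
      atTop (𝓝 (SpectralFBM.specFun q (fun t => BH t ω) i))) ∧
    (∀ i, MemLp (fun ω => SpectralFBM.specFun q (fun t => BH t ω) i) 2 P ∧ Tendsto
      (fun s : Finset ℕ => eLpNorm (fun ω => SpectralFBM.specFun q (fun t => BH t ω) i -
        ∑ j ∈ s, SpectralFBM.specKernel q (SpectralFBM.kernel H) i j *
          SpectralFBM.specWhiteNoise q B P j ω) 2 P)
      atTop (𝓝 0)) := by
  have hBp := hB.toIsPreBrownianReal
  have hk2 := SpectralFBM.memLp_kernel hH0 hH1 T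
  have hk (t : ℝ) (ht : t ∈ Icc 0 T) := SpectralFBM.memLp_kernel_right hH0 hH1 ht
  have hk0 (t τ : ℝ) (h : t ≤ τ) : SpectralFBM.kernel H t τ = 0 := by
    simp [SpectralFBM.kernel, h.not_gt]
  have hBHint (t : ℝ) (ht : t ∈ Icc 0 T) :
      SpectralFBM.IsWienerIntegral B P t (SpectralFBM.kernel H t) (BH t) :=
    (SpectralFBM.isWienerIntegral_wienerIntegral hBp
      (SpectralFBM.memLp_kernel_right hH0 hH1 ⟨ht.1, le_rfl⟩)).congr (hBH t ht).symm
  obtain ⟨W, hW⟩ := SpectralFBM.exists_wienerIsometry hBp T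
  have hWZ (t : ℝ) (ht : t ∈ Icc 0 T) : W (hk t ht).toLp =ᵐ[P] BH t := by
    have h := hBHint t ht
    rw [(SpectralFBM.isWienerIntegral_iff hW (hk t ht) h.2.1).1
      (h.mono ht.2 (hk t ht) fun x hx => hk0 t x hx.le)]
    exact h.2.1.coeFn_toLp
  have hWN (i : ℕ) : SpectralFBM.IsWienerIntegral B P T (q i)
      (SpectralFBM.specWhiteNoise q B P i) :=
    SpectralFBM.isWienerIntegral_wienerIntegral hBp (Lp.memLp (q i))
  have hWV (i : ℕ) : W (q i) =ᵐ[P] SpectralFBM.specWhiteNoise q B P i := by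
    have h := (SpectralFBM.isWienerIntegral_iff hW (Lp.memLp (q i)) (hWN i).2.1).1 (hWN i)
    rw [Lp.toLp_coeFn] at h
    rw [h]
    exact (hWN i).2.1.coeFn_toLp
  have hindep : iIndepFun (fun i => ⇑(W (q i))) P :=
    SpectralFBM.iIndepFun_wienerIsometry hW q.orthonormal
  have hlaw (i : ℕ) : HasLaw (W (q i)) (gaussianReal 0 1) P := by
    have h := SpectralFBM.hasLaw_wienerIsometry hW (q i)
    rwa [show ‖q i‖₊ = 1 from NNReal.eq (q.orthonormal.1 i), one_pow] at h
  -- By the isometry, `E |B_H(t)|² = ‖k_t‖²`, which is bounded uniformly on `[0, T]`.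
  have hZ : MemLp (fun p : ℝ × Ω => BH p.1 p.2) 2 ((SpectralFBM.vol T).prod P) := by
    refine ⟨hBH_meas, ?_⟩
    obtain ⟨M, hM⟩ := SpectralFBM.exists_lintegral_kernel_sq_le hH0 hH1 T
    rw [eLpNorm_lt_top_iff_lintegral_rpow_enorm_lt_top two_ne_zero ENNReal.ofNat_ne_top]
    simp only [ENNReal.toReal_ofNat, ENNReal.rpow_ofNat]
    rw [lintegral_prod _ (hBH_meas.enorm.pow_const 2)]
    calc ∫⁻ t, ∫⁻ ω, ‖BH t ω‖ₑ ^ 2 ∂P ∂(SpectralFBM.vol T) ≤ ∫⁻ _, M ∂(SpectralFBM.vol T) := by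
          refine lintegral_mono_ae ((ae_restrict_mem measurableSet_Icc).mono fun t ht => ?_)
          refine le_trans (le_of_eq ?_) (hM t ht)
          rw [SpectralFBM.lintegral_enorm_sq, SpectralFBM.lintegral_enorm_sq,
            ← eLpNorm_congr_ae (hWZ t ht), ← Lp.enorm_def, ← Lp.enorm_toLp (hk t ht)]
          congr 1
          rw [← ofReal_norm, ← ofReal_norm, W.norm_map]
      _ < ⊤ := by simp [ENNReal.mul_lt_top]
  have hsum (i : ℕ) := SpectralFBM.hasSum_specKernel hk hWZ hZ q hk2 i
  have hspec (i : ℕ) : MemLp (fun ω => SpectralFBM.specFun q (fun t => BH t ω) i) 2 P :=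
    SpectralFBM.memLp_integral_mul hZ (Lp.memLp (q i))
  refine ⟨hBHint, hWN, hindep.congr hWV, fun i => (hlaw i).congr (hWV i).symm, hk2,
    SpectralFBM.specOperator_kernelOperator q hk2 hk0, SpectralFBM.ae_memLp_section hZ, ?_,
    fun i => ⟨hspec i, ?_⟩⟩
  · rw [ae_all_iff]
    intro i
    have h0 (j : ℕ) : ∫ ω, W (q j) ω ∂P = 0 := by
      rw [(hlaw j).integral_eq, integral_id_gaussianReal]
    filter_upwards [SpectralFBM.ae_tendsto_sum_of_hasSum hindep h0 (hsum i), ae_all_iff.2 hWV,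
      (hspec i).coeFn_toLp] with ω h1 h2 h3
    simp only [h2] at h1
    rw [← h3]
    exact h1
  · have hae (s : Finset ℕ) : ⇑(∑ j ∈ s, SpectralFBM.specKernel q (SpectralFBM.kernel H) i j •
        W (q j)) =ᵐ[P] fun ω => ∑ j ∈ s, SpectralFBM.specKernel q (SpectralFBM.kernel H) i j *
          SpectralFBM.specWhiteNoise q B P j ω := by
      filter_upwards [SpectralFBM.coeFn_sum_smul _ (fun j => W (q j)) s, ae_all_iff.2 hWV]
        with ω h1 h2
      rw [h1]
      exact Finset.sum_congr rfl fun j _ => by rw [h2]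
    have h := hsum i
    rw [HasSum, SummationFilter.unconditional_filter] at h
    refine ((SpectralFBM.tendsto_toLp_iff hae (hspec i)).1 h).congr fun s => ?_
    exact eLpNorm_sub_comm _ _ _ _
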